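/- Let $m,N\ge 1$ be integers, let $0=h_0<h_1<\dots<h_{N-1}$ be real delays, let $T>0$ and $\frac12<\theta<1$. Let $W=(W_t)_{t\in\mathbb R}$ be a two-sided $m$-dimensional Brownian motion on a probability space, i.e. $(W_t)_{t\ge 0}$ and $(W_{-t})_{t\ge 0}$ are independent $m$-dimensional Brownian motions started at $0$, with almost surely continuous paths. Put $$\mathcal W_t=(W_t,W_{t-h_1},\dots,W_{t-h_{N-1}})\in V:=\mathbb R^{m\times N},\qquad \mathcal W_{s,t}=\mathcal W_t-\mathcal W_s,$$ where $V$ and its dual $V^*$ carry the Euclidean norm. A path $X:[0,T]\to V$ is called $\theta$-Hölder rough on scale $\varepsilon_0>0$ on $[0,T]$ if there is $L>0$ such that for all $\varphi\in V^*$, $s\in[0,T]$ and $\varepsilon\in(0,\varepsilon_0)$ there is $t\in[0,T]$ with $|t-s|\le\varepsilon$ and $|\varphi (X_t-X_s)|\ge L\varepsilon^\theta|\varphi|$. (i) There is a version of $W$ (a two-sided Brownian motion $W'$ on the same probability space, indistinguishable from $W$ and with all paths continuous) such that every path of the process $(W'_t,W'_{t-h_1},\dots,W'_{t-h_{N-1}})$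 is $\theta$-Hölder rough on scale $\frac T2$ on $[0,T]$. (ii) Let $\Delta(h)=\min_{0\le i\le N-2}|h_i-h_{i+1}|$, with $\Delta(h)=\infty$ if $N=1$. There are absolute constants $c,C>0$ such that for all $s\in\mathbb R$, $\varepsilon>0$, $\delta>0$ and $\varphi\in V^*$, $$\mathbb P\Big(\sup_{s\le t\le s+\delta}|\varphi\,\mathcal W_{s,t}|<\varepsilon\Big)\le C\exp\Big(-\frac{c\,|\varphi|^2\,(\delta\wedge\Delta(h))}{\varepsilon^2}\Big).$$ -/

import Mathlib

open MeasureTheory ProbabilityTheory Set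
open scoped NNReal ENNReal

/-- An `m`-dimensional Brownian motion indexed by `[0, ∞)`: the coordinates are independent
standard real Brownian motions (started at `0`, almost surely continuous). -/
structure IsBrownianVector {Ω : Type*} [MeasurableSpace Ω] {m : ℕ}
    (B : ℝ≥0 → Ω → EuclideanSpace ℝ (Fin m)) (P : Measure Ω) : Prop where
  brownian : ∀ k : Fin m, IsBrownianReal (fun t ω => B t ω k) P
  indep : iIndepFun (fun (k : Fin m) (ω : Ω) (t : ℝ≥0) => B t ω k) P

/-- A two-sided `m`-dimensional Brownian motion: `(W_t)_{t ≥ 0}` and `(W_{-t})_{t ≥ 0}` are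
independent Brownian motions. -/
structure IsTwoSidedBrownian {Ω : Type*} [MeasurableSpace Ω] {m : ℕ}
    (W : ℝ → Ω → EuclideanSpace ℝ (Fin m)) (P : Measure Ω) : Prop where
  measurable : ∀ t : ℝ, Measurable (W t)
  forward : IsBrownianVector (fun (t : ℝ≥0) ω => W (t : ℝ) ω) P
  backward : IsBrownianVector (fun (t : ℝ≥0) ω => W (-(t : ℝ)) ω) P
  indep : IndepFun (fun (ω : Ω) (t : ℝ≥0) => W (t : ℝ) ω)
    (fun (ω : Ω) (t : ℝ≥0) => W (-(t : ℝ)) ω) P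

/-- The delayed path `t ↦ (w (t - h₀), …, w (t - h_{N-1}))` with values in `ℝ^{m × N}`, which
carries the Euclidean norm. -/
noncomputable def delayedPath {m N : ℕ} (h : Fin N → ℝ) (w : ℝ → EuclideanSpace ℝ (Fin m))
    (t : ℝ) : EuclideanSpace ℝ (Fin m × Fin N) :=
  WithLp.toLp 2 (fun p => w (t - h p.2) p.1)

/-- The path `X`, restricted to `[0, T]`, is `θ`-Hölder rough on scale `ε₀`. -/
def IsHolderRough {V : Type*} [NormedAddCommGroup V] [NormedSpace ℝ V]
    (θ ε₀ T : ℝ) (X : ℝ → V) : Prop :=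
  ∃ L : ℝ, 0 < L ∧ ∀ φ : StrongDual ℝ V, ∀ s ∈ Icc (0 : ℝ) T, ∀ ε ∈ Ioo (0 : ℝ) ε₀,
    ∃ t ∈ Icc (0 : ℝ) T, |t - s| ≤ ε ∧ L * ε ^ θ * ‖φ‖ ≤ |φ (X t - X s)|

/-- The smallest gap `min_{0 ≤ i ≤ N-2} |h_i - h_{i+1}|` between consecutive delays, equal to `∞`
when `N = 1`. -/
noncomputable def minDelayGap {N : ℕ} (h : Fin N → ℝ) : ℝ≥0∞ :=
  ⨅ (i : ℕ) (hi : i + 1 < N), ENNReal.ofReal |h ⟨i, Nat.lt_of_succ_lt hi⟩ - h ⟨i + 1, hi⟩|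

section

variable {Ω : Type*} [MeasurableSpace Ω] {P : Measure Ω} {m N : ℕ}

/-- The coordinates of a Brownian vector form a Gaussian process. -/
lemma IsBrownianVector.isGaussianProcess {B : ℝ≥0 → Ω → EuclideanSpace ℝ (Fin m)}
    (hB : IsBrownianVector B P) :
    IsGaussianProcess (fun (p : Fin m × ℝ≥0) ω => B p.2 ω p.1) P where
  hasGaussianLaw I := by
    classical
    let J : Finset ℝ≥0 := I.image Prod.snd
    have h1 (k : Fin m) : HasGaussianLaw (fun ω (t : J) => B t ω k) P :=
      ((hB.brownian k).hasLaw J).hasGaussianLaw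
    have h2 : iIndepFun (fun (k : Fin m) ω (t : J) => B t ω k) P :=
      hB.indep.comp (fun _ x (t : J) => x t) (fun _ => by fun_prop)
    let L : (Fin m → J → ℝ) →L[ℝ] (I → ℝ) :=
      ContinuousLinearMap.pi fun p : I =>
        (ContinuousLinearMap.proj
          (⟨p.1.2, Finset.mem_image_of_mem _ p.2⟩ : J)).comp
          (ContinuousLinearMap.proj (R := ℝ) (φ := fun _ : Fin m => J → ℝ) p.1.1)
    exact (h2.hasGaussianLaw h1).map L

/-- Two independent Gaussian processes are jointly Gaussian. -/
lemma IsGaussianProcess.sumElim {S T : Type*} {X : S → Ω → ℝ} {Y : T → Ω → ℝ}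
    (hX : IsGaussianProcess X P) (hY : IsGaussianProcess Y P)
    (hXY : IndepFun (fun ω s => X s ω) (fun ω t => Y t ω) P) :
    IsGaussianProcess (Sum.elim X Y) P where
  hasGaussianLaw I := by
    have h : IndepFun (fun ω (s : I.toLeft) => X s ω) (fun ω (t : I.toRight) => Y t ω) P :=
      hXY.comp (φ := fun (x : S → ℝ) (s : I.toLeft) => x s)
        (ψ := fun (y : T → ℝ) (t : I.toRight) => y t) (by fun_prop) (by fun_prop)
    let L : (I.toLeft → ℝ) × (I.toRight → ℝ) →L[ℝ] (I → ℝ) :=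
      ContinuousLinearMap.pi fun p : I =>
        match p with
        | ⟨.inl s, hs⟩ => (ContinuousLinearMap.proj (⟨s, by simpa using hs⟩ : I.toLeft)).comp
            (ContinuousLinearMap.fst ℝ _ _)
        | ⟨.inr t, ht⟩ => (ContinuousLinearMap.proj (⟨t, by simpa using ht⟩ : I.toRight)).comp
            (ContinuousLinearMap.snd ℝ _ _)
    convert! (h.hasGaussianLaw (hX.hasGaussianLaw I.toLeft) (hY.hasGaussianLaw I.toRight)).map L
      using 1
    ext ω ⟨p, hp⟩
    cases p <;> rfl

namespace IsTwoSidedBrownian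

variable {W : ℝ → Ω → EuclideanSpace ℝ (Fin m)}

lemma measurable_coord (hW : IsTwoSidedBrownian W P) (k : Fin m) (t : ℝ) :
    Measurable (fun ω => W t ω k) := by
  have := hW.measurable t
  fun_prop

/-- The coordinates of a two-sided Brownian motion form a Gaussian process. -/
lemma isGaussianProcess (hW : IsTwoSidedBrownian W P) :
    IsGaussianProcess (fun (p : Fin m × ℝ) ω => W p.2 ω p.1) P := by
  have hi : IndepFun (fun ω (p : Fin m × ℝ≥0) => W p.2 ω p.1)
      (fun ω (p : Fin m × ℝ≥0) => W (-p.2) ω p.1) P :=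
    hW.indep.comp
      (φ := fun (x : ℝ≥0 → EuclideanSpace ℝ (Fin m)) (p : Fin m × ℝ≥0) => x p.2 p.1)
      (ψ := fun (x : ℝ≥0 → EuclideanSpace ℝ (Fin m)) (p : Fin m × ℝ≥0) => x p.2 p.1)
      (by fun_prop) (by fun_prop)
  refine (IsGaussianProcess.sumElim hW.forward.isGaussianProcess
    hW.backward.isGaussianProcess hi).comp_right
    (fun p : Fin m × ℝ => if 0 ≤ p.2 then .inl (p.1, p.2.toNNReal)
      else .inr (p.1, (-p.2).toNNReal)) |>.congr fun p => .of_forall fun ω => ?_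
  by_cases h : 0 ≤ p.2
  · simp [h]
  · simp [h, Real.coe_toNNReal _ (neg_nonneg.2 (not_le.1 h).le)]

lemma memLp_two (hW : IsTwoSidedBrownian W P) (k : Fin m) (t : ℝ) :
    MemLp (fun ω => W t ω k) 2 P :=
  (hW.isGaussianProcess.hasGaussianLaw_eval (k, t)).memLp_two

lemma integral_coord (hW : IsTwoSidedBrownian W P) (k : Fin m) (t : ℝ) :
    ∫ ω, W t ω k ∂P = 0 := by
  rcases le_total 0 t with h | h
  · simpa [h] using (hW.forward.brownian k).integral_eval t.toNNReal
  · simpa [h, Real.coe_toNNReal _ (neg_nonneg.2 h)] using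
      (hW.backward.brownian k).integral_eval (-t).toNNReal

lemma covariance_coord_same (hW : IsTwoSidedBrownian W P) (k : Fin m) (s t : ℝ) :
    cov[fun ω => W s ω k, fun ω => W t ω k; P] = (|s| + |t| - |s - t|) / 2 := by
  have hF (a b : ℝ) (ha : 0 ≤ a) (hb : 0 ≤ b) :
      cov[fun ω => W a ω k, fun ω => W b ω k; P] = min a b := by
    simpa [ha, hb] using
      (hW.forward.brownian k).covariance_fun_eval a.toNNReal b.toNNReal
  have hB (a b : ℝ) (ha : 0 ≤ a) (hb : 0 ≤ b) :
      cov[fun ω => W (-a) ω k, fun ω => W (-b) ω k; P] = min a b := by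
    simpa [ha, hb] using
      (hW.backward.brownian k).covariance_fun_eval a.toNNReal b.toNNReal
  have hM (a b : ℝ) (ha : 0 ≤ a) (hb : 0 ≤ b) :
      cov[fun ω => W a ω k, fun ω => W (-b) ω k; P] = 0 := by
    have h := hW.indep.comp (φ := fun x => x a.toNNReal k) (ψ := fun x => x b.toNNReal k)
      (by fun_prop) (by fun_prop)
    have := h.covariance_eq_zero
      (by simpa [Function.comp_def, ha] using hW.memLp_two k a)
      (by simpa [Function.comp_def, hb] using hW.memLp_two k (-b))
    simpa [Function.comp_def, ha, hb] using this
  have hmin (a b : ℝ) : min a b = (a + b - |a - b|) / 2 := by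
    rcases le_total a b with h | h
    · rw [min_eq_left h, abs_of_nonpos (by linarith)]; ring
    · rw [min_eq_right h, abs_of_nonneg (by linarith)]; ring
  rcases le_total 0 s with hs | hs <;> rcases le_total 0 t with ht | ht
  · rw [hF s t hs ht, hmin, abs_of_nonneg hs, abs_of_nonneg ht]
  · have := hM s (-t) hs (neg_nonneg.2 ht)
    rw [neg_neg] at this
    rw [this, abs_of_nonneg hs, abs_of_nonpos ht, abs_of_nonneg (by linarith)]
    ring
  · have := hM t (-s) ht (neg_nonneg.2 hs)
    rw [neg_neg] at this
    rw [covariance_comm, this, abs_of_nonneg ht, abs_of_nonpos hs, abs_of_nonpos (by linarith)]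
    ring
  · have := hB (-s) (-t) (neg_nonneg.2 hs) (neg_nonneg.2 ht)
    rw [neg_neg, neg_neg] at this
    rw [this, hmin, abs_of_nonpos hs, abs_of_nonpos ht, ← neg_sub' , abs_neg]

lemma covariance_coord_ne (hW : IsTwoSidedBrownian W P) {k l : Fin m} (hkl : k ≠ l) (s t : ℝ) :
    cov[fun ω => W s ω k, fun ω => W t ω l; P] = 0 := by
  have key : ∀ a b : ℝ≥0, cov[fun ω => W a ω k, fun ω => W b ω l; P] = 0 := fun a b =>
    ((hW.forward.indep.indepFun hkl).comp (φ := fun x : ℝ≥0 → ℝ => x a)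
      (ψ := fun x : ℝ≥0 → ℝ => x b)
      (by fun_prop) (by fun_prop)).covariance_eq_zero
      (hW.memLp_two k a) (hW.memLp_two l b)
  have key' : ∀ a b : ℝ≥0, cov[fun ω => W (-a) ω k, fun ω => W (-b) ω l; P] = 0 := fun a b =>
    ((hW.backward.indep.indepFun hkl).comp (φ := fun x : ℝ≥0 → ℝ => x a)
      (ψ := fun x : ℝ≥0 → ℝ => x b)
      (by fun_prop) (by fun_prop)).covariance_eq_zero
      (hW.memLp_two k _) (hW.memLp_two l _)
  have key'' : ∀ (i j : Fin m) (a b : ℝ≥0),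
      cov[fun ω => W a ω i, fun ω => W (-b) ω j; P] = 0 := fun i j a b =>
    (hW.indep.comp (φ := fun x : ℝ≥0 → EuclideanSpace ℝ (Fin m) => x a i)
      (ψ := fun x : ℝ≥0 → EuclideanSpace ℝ (Fin m) => x b j)
      (by fun_prop) (by fun_prop)).covariance_eq_zero
      (hW.memLp_two i _) (hW.memLp_two j _)
  have hpm (x : ℝ) : ∃ a : ℝ≥0, x = a ∨ x = -a := by
    rcases le_total 0 x with h | h
    · exact ⟨x.toNNReal, .inl (by simp [h])⟩
    · exact ⟨(-x).toNNReal, .inr (by simp [h])⟩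
  obtain ⟨a, rfl | rfl⟩ := hpm s <;> obtain ⟨b, rfl | rfl⟩ := hpm t
  · exact key a b
  · exact key'' k l a b
  · rw [covariance_comm]; exact key'' l k b a
  · exact key' a b

/-- Increments of a two-sided Brownian motion over intervals which are in order, or of distinct
coordinates, are uncorrelated. -/
lemma covariance_increments_eq_zero (hW : IsTwoSidedBrownian W P) {k l : Fin m} {a b c d : ℝ}
    (hab : a ≤ b) (hcd : c ≤ d) (h : k ≠ l ∨ b ≤ c ∨ d ≤ a) :
    cov[fun ω => W b ω k - W a ω k, fun ω => W d ω l - W c ω l; P] = 0 := by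
  have := hW.isGaussianProcess.isProbabilityMeasure
  rw [covariance_fun_sub_fun_sub (hW.memLp_two _ _) (hW.memLp_two _ _) (hW.memLp_two _ _)
    (hW.memLp_two _ _)]
  by_cases hkl : k = l
  · subst hkl
    simp only [hW.covariance_coord_same]
    rcases h with h | h | h
    · exact absurd rfl h
    · rw [abs_of_nonpos (by linarith : b - d ≤ 0), abs_of_nonpos (by linarith : b - c ≤ 0),
        abs_of_nonpos (by linarith : a - d ≤ 0), abs_of_nonpos (by linarith : a - c ≤ 0)]
      ring
    · rw [abs_of_nonneg (by linarith : 0 ≤ b - d), abs_of_nonneg (by linarith : 0 ≤ b - c),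
        abs_of_nonneg (by linarith : 0 ≤ a - d), abs_of_nonneg (by linarith : 0 ≤ a - c)]
      ring
  · simp [hW.covariance_coord_ne hkl]

lemma covariance_increment_self (hW : IsTwoSidedBrownian W P) (k : Fin m) {a b : ℝ}
    (hab : a ≤ b) :
    cov[fun ω => W b ω k - W a ω k, fun ω => W b ω k - W a ω k; P] = b - a := by
  have := hW.isGaussianProcess.isProbabilityMeasure
  rw [covariance_fun_sub_fun_sub (hW.memLp_two _ _) (hW.memLp_two _ _) (hW.memLp_two _ _)
    (hW.memLp_two _ _)]
  simp only [hW.covariance_coord_same, sub_self, abs_zero]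
  rw [abs_of_nonneg (sub_nonneg.2 hab), abs_of_nonpos (sub_nonpos.2 hab)]
  ring

end IsTwoSidedBrownian

lemma EuclideanSpace.exists_dual_coeff {ι : Type*} [Fintype ι]
    (φ : StrongDual ℝ (EuclideanSpace ℝ ι)) :
    ∃ c : ι → ℝ, (∀ x, φ x = ∑ p, c p * x p) ∧ ∑ p, c p ^ 2 = ‖φ‖ ^ 2 := by
  set a := (InnerProductSpace.toDual ℝ (EuclideanSpace ℝ ι)).symm φ with ha
  refine ⟨fun p => a p, fun x => ?_, ?_⟩
  · rw [← InnerProductSpace.toDual_symm_apply, ← ha, PiLp.inner_apply]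
    simp [mul_comm]
  · rw [← (InnerProductSpace.toDual ℝ (EuclideanSpace ℝ ι)).symm.norm_map φ, ← ha,
      EuclideanSpace.norm_sq_eq]
    simp

namespace IsTwoSidedBrownian

variable {W : ℝ → Ω → EuclideanSpace ℝ (Fin m)}

lemma measurable_delayedPath (hW : IsTwoSidedBrownian W P) (h : Fin N → ℝ)
    (φ : StrongDual ℝ (EuclideanSpace ℝ (Fin m × Fin N))) (t : ℝ) :
    Measurable fun ω => φ (delayedPath h (fun u => W u ω) t) := by
  obtain ⟨c, hc, -⟩ := EuclideanSpace.exists_dual_coeff φ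
  simp only [hc, delayedPath]
  exact Finset.measurable_sum _ fun p _ => (hW.measurable_coord _ _).const_mul _

/-- Linear functionals of the delayed path form a Gaussian process. -/
lemma isGaussianProcess_delayedPath (hW : IsTwoSidedBrownian W P) (h : Fin N → ℝ)
    (φ : StrongDual ℝ (EuclideanSpace ℝ (Fin m × Fin N))) :
    IsGaussianProcess (fun t ω => φ (delayedPath h (fun u => W u ω) t)) P := by
  classical
  refine hW.isGaussianProcess.of_isGaussianProcess fun t => ?_
  let I : Finset (Fin m × ℝ) :=
    Finset.univ.image fun p : Fin m × Fin N => (p.1, t - h p.2)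
  let L : (I → ℝ) →ₗ[ℝ] EuclideanSpace ℝ (Fin m × Fin N) :=
    { toFun x := WithLp.toLp 2 fun p =>
        x ⟨(p.1, t - h p.2), Finset.mem_image_of_mem _ (Finset.mem_univ p)⟩
      map_add' x y := rfl
      map_smul' c x := rfl }
  exact ⟨I, φ.comp L.toContinuousLinearMap, fun ω => rfl⟩

lemma integral_delayedPath (hW : IsTwoSidedBrownian W P) (h : Fin N → ℝ)
    (φ : StrongDual ℝ (EuclideanSpace ℝ (Fin m × Fin N))) (t : ℝ) :
    ∫ ω, φ (delayedPath h (fun u => W u ω) t) ∂P = 0 := by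
  have := hW.isGaussianProcess.isProbabilityMeasure
  obtain ⟨c, hc, -⟩ := EuclideanSpace.exists_dual_coeff φ
  simp only [hc, delayedPath]
  rw [integral_finsetSum _ fun (p : Fin m × Fin N) _ =>
    ((hW.memLp_two p.1 (t - h p.2)).integrable (by norm_num)).const_mul (c p)]
  simp [integral_const_mul, hW.integral_coord]

/-- Covariances of increments of the delayed path in terms of those of the Brownian motion. -/
lemma covariance_delayedPath_increments (hW : IsTwoSidedBrownian W P) (h : Fin N → ℝ)
    {φ : StrongDual ℝ (EuclideanSpace ℝ (Fin m × Fin N))} {c : Fin m × Fin N → ℝ}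
    (hc : ∀ x, φ x = ∑ p, c p * x p) (a b a' b' : ℝ) :
    cov[fun ω => φ (delayedPath h (fun u => W u ω) b) - φ (delayedPath h (fun u => W u ω) a),
      fun ω => φ (delayedPath h (fun u => W u ω) b') - φ (delayedPath h (fun u => W u ω) a'); P]
      = ∑ p, ∑ q, c p * c q * cov[fun ω => W (b - h p.2) ω p.1 - W (a - h p.2) ω p.1,
          fun ω => W (b' - h q.2) ω q.1 - W (a' - h q.2) ω q.1; P] := by
  have := hW.isGaussianProcess.isProbabilityMeasure
  have e (a b : ℝ) (ω : Ω) :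
      φ (delayedPath h (fun u => W u ω) b) - φ (delayedPath h (fun u => W u ω) a)
        = ∑ p, c p * (W (b - h p.2) ω p.1 - W (a - h p.2) ω p.1) := by
    simp only [hc, delayedPath, mul_sub, Finset.sum_sub_distrib]
  have hm (a b : ℝ) (p : Fin m × Fin N) :
      MemLp (fun ω => c p * (W (b - h p.2) ω p.1 - W (a - h p.2) ω p.1)) 2 P :=
    ((hW.memLp_two _ _).sub (hW.memLp_two _ _)).const_mul _
  simp only [e]
  rw [covariance_fun_sum_fun_sum (hm a b) (hm a' b')]
  refine Finset.sum_congr rfl fun p _ => Finset.sum_congr rfl fun q _ => ?_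
  rw [covariance_const_mul_left, covariance_const_mul_right, mul_assoc]

variable {h : Fin N → ℝ} {δ s : ℝ}

/-- Within a window shorter than all gaps between delays, the increments of a linear functional of
the delayed path are uncorrelated. -/
lemma covariance_delayedPath_increments_eq_zero (hW : IsTwoSidedBrownian W P)
    (hgap : ∀ i j, i < j → δ ≤ h j - h i)
    (φ : StrongDual ℝ (EuclideanSpace ℝ (Fin m × Fin N))) {a b a' b' : ℝ}
    (hsa : s ≤ a) (hab : a ≤ b) (hba' : b ≤ a') (hab' : a' ≤ b') (hb' : b' ≤ s + δ) :
    cov[fun ω => φ (delayedPath h (fun u => W u ω) b) - φ (delayedPath h (fun u => W u ω) a),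
      fun ω => φ (delayedPath h (fun u => W u ω) b') - φ (delayedPath h (fun u => W u ω) a'); P]
      = 0 := by
  obtain ⟨c, hc, -⟩ := EuclideanSpace.exists_dual_coeff φ
  rw [hW.covariance_delayedPath_increments h hc]
  refine Finset.sum_eq_zero fun p _ => Finset.sum_eq_zero fun q _ => ?_
  rw [hW.covariance_increments_eq_zero (by linarith) (by linarith), mul_zero]
  right
  rcases lt_trichotomy p.2 q.2 with hpq | hpq | hpq
  · right; linarith [hgap _ _ hpq]
  · left; rw [hpq]; linarith
  · left; linarith [hgap _ _ hpq]

lemma variance_delayedPath_increment (hW : IsTwoSidedBrownian W P)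
    (hgap : ∀ i j, i < j → δ ≤ h j - h i)
    (φ : StrongDual ℝ (EuclideanSpace ℝ (Fin m × Fin N))) {a b : ℝ}
    (hab : a ≤ b) (hb : b ≤ a + δ) :
    Var[fun ω => φ (delayedPath h (fun u => W u ω) b)
      - φ (delayedPath h (fun u => W u ω) a); P] = ‖φ‖ ^ 2 * (b - a) := by
  obtain ⟨c, hc, hn⟩ := EuclideanSpace.exists_dual_coeff φ
  have hm : Measurable fun ω => φ (delayedPath h (fun u => W u ω) b)
      - φ (delayedPath h (fun u => W u ω) a) :=
    (hW.measurable_delayedPath h φ b).sub (hW.measurable_delayedPath h φ a)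
  rw [← covariance_self hm.aemeasurable, hW.covariance_delayedPath_increments h hc, ← hn, Finset.sum_mul]
  refine Finset.sum_congr rfl fun p _ => ?_
  rw [Finset.sum_eq_single p]
  · rw [hW.covariance_increment_self _ (by linarith)]; ring
  · intro q _ hqp
    rw [hW.covariance_increments_eq_zero (by linarith) (by linarith), mul_zero]
    by_cases h1 : p.1 = q.1
    · right
      rcases lt_trichotomy p.2 q.2 with hpq | hpq | hpq
      · right; linarith [hgap _ _ hpq]
      · exact absurd (Prod.ext h1 hpq).symm hqp
      · left; linarith [hgap _ _ hpq]
    · exact .inl h1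
  · simp

end IsTwoSidedBrownian

/-- A centred Gaussian with standard deviation `4 ε` lies in `(-2 ε, 2 ε)` with probability at most
one half. -/
lemma gaussianReal_Ioo_le_half {ε : ℝ} (hε : 0 < ε) :
    gaussianReal 0 (16 * ε ^ 2).toNNReal (Ioo (-(2 * ε)) (2 * ε)) ≤ ENNReal.ofReal (1 / 2) := by
  have hv : (0 : ℝ) < 16 * ε ^ 2 := by positivity
  have hv' : (16 * ε ^ 2).toNNReal ≠ 0 := by simpa using pow_pos hε 2
  have hsq : 8 * ε ≤ √(2 * Real.pi * (16 * ε ^ 2)) := by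
    apply Real.le_sqrt_of_sq_le
    nlinarith [Real.two_le_pi, sq_nonneg ε]
  have hle (x : ℝ) : gaussianPDFReal 0 (16 * ε ^ 2).toNNReal x ≤ (8 * ε)⁻¹ := by
    rw [gaussianPDFReal, Real.coe_toNNReal _ hv.le]
    calc _ ≤ (√(2 * Real.pi * (16 * ε ^ 2)))⁻¹ * 1 := by
          gcongr
          rw [Real.exp_le_one_iff]
          exact div_nonpos_of_nonpos_of_nonneg (neg_nonpos.2 (sq_nonneg _)) (by positivity)
      _ ≤ _ := by rw [mul_one]; gcongr
  rw [gaussianReal_apply_eq_integral _ hv']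
  apply ENNReal.ofReal_le_ofReal
  calc _ ≤ ∫ x in Ioo (-(2 * ε)) (2 * ε), (8 * ε)⁻¹ :=
        setIntegral_mono (integrable_gaussianPDFReal _ _).restrict
          (integrableOn_const (by simp)) hle
    _ = 1 / 2 := by
        rw [setIntegral_const, measureReal_def, Real.volume_Ioo, ENNReal.toReal_ofReal (by linarith),
          smul_eq_mul]
        field_simp
        norm_num

/-- Small-ball estimate for linear functionals of the delayed path, over a window shorter than all
gaps between delays. -/
lemma IsTwoSidedBrownian.measure_small_ball_le {W : ℝ → Ω → EuclideanSpace ℝ (Fin m)}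
    (hW : IsTwoSidedBrownian W P) {h : Fin N → ℝ} {δ : ℝ} (hδ : 0 ≤ δ)
    (hgap : ∀ i j, i < j → δ ≤ h j - h i)
    (φ : StrongDual ℝ (EuclideanSpace ℝ (Fin m × Fin N))) (s : ℝ) {ε : ℝ} (hε : 0 < ε) :
    P.real {ω | ∀ t ∈ Icc s (s + δ), |φ (delayedPath h (fun u => W u ω) t)
        - φ (delayedPath h (fun u => W u ω) s)| < ε}
      ≤ 2 * Real.exp (-(Real.log 2 / 16 * ‖φ‖ ^ 2 * δ) / ε ^ 2) := by
  have := hW.isGaussianProcess.isProbabilityMeasure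
  set Z : ℝ → Ω → ℝ := fun t ω => φ (delayedPath h (fun u => W u ω) t)
  rcases eq_or_ne φ 0 with h0 | h0
  · refine measureReal_le_one.trans ?_
    simp [h0]
  have hr : 0 < ‖φ‖ := norm_pos_iff.2 h0
  set τ : ℝ := 16 * ε ^ 2 / ‖φ‖ ^ 2 with hτ
  have hτ0 : 0 < τ := by positivity
  set n : ℕ := ⌊δ / τ⌋₊
  have hnτ : n * τ ≤ δ := by
    rw [← le_div_iff₀ hτ0]
    exact Nat.floor_le (by positivity)
  let t : ℕ → ℝ := fun j => s + j * τ
  have ht1 (j : ℕ) : t j ≤ t (j + 1) := by simp only [t]; push_cast; linarith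
  have ht_mono : Monotone t := monotone_nat_of_le_succ ht1
  have ht0 (j : ℕ) : s ≤ t j := by simp only [t]; nlinarith [Nat.cast_nonneg (α := ℝ) j]
  have htn (j : ℕ) (hj : j ≤ n) : t j ≤ s + δ := by
    have : (j : ℝ) * τ ≤ n * τ := by gcongr
    simp only [t]; linarith
  let ξ : Fin n → Ω → ℝ := fun j ω => Z (t (j + 1)) ω - Z (t j) ω
  have hG : HasGaussianLaw (fun ω (j : Fin n) => ξ j ω) P := by
    simpa [ξ] using (hW.isGaussianProcess_delayedPath h φ).hasGaussianLaw_increments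
      (t := fun i : Fin (n + 1) => t i)
  have hcov {i j : Fin n} (hij : i < j) : cov[ξ i, ξ j; P] = 0 :=
    hW.covariance_delayedPath_increments_eq_zero hgap φ (ht0 i) (ht1 i)
      (ht_mono (Nat.succ_le_of_lt hij)) (ht1 j) (htn _ j.2)
  have hind : iIndepFun ξ P := hG.iIndepFun_of_covariance_eq_zero fun i j hij => by
    rcases hij.lt_or_gt with h | h
    · exact hcov h
    · rw [covariance_comm]; exact hcov h
  have hvar (j : Fin n) : Var[ξ j; P] = 16 * ε ^ 2 := by
    have h1 : t (j + 1) - t j = τ := by simp only [t]; push_cast; ring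
    have h2 : (1 : ℝ) ≤ n := by exact_mod_cast (Nat.zero_le _).trans_lt j.2
    rw [hW.variance_delayedPath_increment hgap φ (ht1 j) (by nlinarith), h1, hτ]
    field_simp
  have hmean (j : Fin n) : ∫ ω, ξ j ω ∂P = 0 := by
    have hi (t : ℝ) := ((hW.isGaussianProcess_delayedPath h φ).hasGaussianLaw_eval t).integrable
    rw [integral_sub (hi _) (hi _), hW.integral_delayedPath, hW.integral_delayedPath, sub_zero]
  have hmeas (j : Fin n) : Measurable (ξ j) :=
    (hW.measurable_delayedPath h φ _).sub (hW.measurable_delayedPath h φ _)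
  have hone (j : Fin n) :
      P (ξ j ⁻¹' Ioo (-(2 * ε)) (2 * ε)) ≤ ENNReal.ofReal (1 / 2) := by
    rw [← Measure.map_apply (hmeas j) measurableSet_Ioo, (hG.eval j).map_eq_gaussianReal,
      hvar, hmean]
    exact gaussianReal_Ioo_le_half hε
  have hall : P {ω | ∀ t ∈ Icc s (s + δ), |Z t ω - Z s ω| < ε} ≤ ENNReal.ofReal ((1 / 2) ^ n) := by
    calc _ ≤ P (⋂ j ∈ Finset.univ, ξ j ⁻¹' Ioo (-(2 * ε)) (2 * ε)) := by
          refine measure_mono fun ω hω => ?_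
          simp only [Finset.mem_univ, iInter_true, mem_iInter, mem_preimage]
          intro j
          have h1 := abs_lt.1 (hω (t j) ⟨ht0 _, htn _ j.2.le⟩)
          have h2 := abs_lt.1 (hω (t (j + 1)) ⟨ht0 _, htn _ j.2⟩)
          exact ⟨by simp only [ξ]; linarith, by simp only [ξ]; linarith⟩
      _ = ∏ j, P (ξ j ⁻¹' Ioo (-(2 * ε)) (2 * ε)) :=
          hind.measure_inter_preimage_eq_mul _ fun _ _ => measurableSet_Ioo
      _ ≤ ∏ j : Fin n, ENNReal.ofReal (1 / 2) := Finset.prod_le_prod' fun j _ => hone j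
      _ = _ := by rw [Finset.prod_const, ← ENNReal.ofReal_pow (by norm_num)]; simp
  calc P.real _ ≤ (1 / 2) ^ n := ENNReal.toReal_le_of_le_ofReal (by positivity) hall
    _ = Real.exp (-(Real.log 2 * n)) := by
        rw [one_div, inv_pow, Real.exp_neg, mul_comm, Real.exp_nat_mul, Real.exp_log two_pos]
    _ ≤ Real.exp (Real.log 2 + -(Real.log 2 / 16 * ‖φ‖ ^ 2 * δ) / ε ^ 2) := by
        gcongr
        have h1 : δ / τ < n + 1 := Nat.lt_floor_add_one _
        have h2 : Real.log 2 / 16 * ‖φ‖ ^ 2 * δ / ε ^ 2 = Real.log 2 * (δ / τ) := by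
          rw [hτ]; field_simp
        rw [neg_div, h2]
        nlinarith [Real.log_pos one_lt_two]
    _ = _ := by rw [Real.exp_add, Real.exp_log two_pos]

/-- A path which oscillates by at least `2 ^ (-n θ)` on every sufficiently fine dyadic subinterval
of `[0, T]`, in every direction, is `θ`-Hölder rough. -/
lemma isHolderRough_of_dyadic {V : Type*} [NormedAddCommGroup V] [NormedSpace ℝ V] {X : ℝ → V}
    {θ T : ℝ} (hT : 0 < T) (hθ : 0 < θ) (n₀ : ℕ)
    (H : ∀ n ≥ n₀, ∀ k : ℕ, k < 2 ^ n → ∀ φ : StrongDual ℝ V, ‖φ‖ = 1 →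
      ∃ t ∈ Icc ((k : ℝ) * (T / 2 ^ n)) (k * (T / 2 ^ n) + T / 2 ^ n),
        ((2 : ℝ) ^ n) ^ (-θ) ≤ |φ (X t) - φ (X (k * (T / 2 ^ n)))|) :
    IsHolderRough θ (T / 2) T X := by
  set A : ℝ := 2 ^ n₀ * (4 * T) with hA
  have hA0 : 0 < A := by positivity
  refine ⟨A ^ (-θ) / 2, by positivity, fun φ s hs ε hε => ?_⟩
  rcases eq_or_ne φ 0 with rfl | hφ
  · exact ⟨s, hs, by simpa using hε.1.le, by simp⟩
  have hr : 0 < ‖φ‖ := norm_pos_iff.2 hφ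
  obtain ⟨p, hp1, hp2⟩ := exists_nat_pow_near (x := 2 * T / ε) (y := (2 : ℝ))
    (by rw [le_div_iff₀ hε.1]; linarith [hε.2]) one_lt_two
  set n : ℕ := n₀ + (p + 1) with hn
  set τ : ℝ := T / 2 ^ n with hτ
  have hτ0 : 0 < τ := by positivity
  have hnτ : (2 ^ n : ℕ) * τ = T := by rw [hτ]; push_cast; field_simp
  have hp3 : T / 2 ^ (p + 1) ≤ ε / 2 := by
    rw [div_lt_iff₀ hε.1] at hp2
    rw [div_le_iff₀ (by positivity)]
    linarith
  have hτε : τ ≤ ε / 2 := le_trans (by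
    rw [hτ]
    gcongr
    · norm_num
    · omega) hp3
  have hpow : (2 : ℝ) ^ n ≤ A / ε := by
    rw [le_div_iff₀ hε.1] at hp1 ⊢
    calc (2 : ℝ) ^ n * ε = 2 ^ n₀ * (2 * (2 ^ p * ε)) := by rw [hn]; ring
      _ ≤ 2 ^ n₀ * (2 * (2 * T)) := by gcongr
      _ = A := by rw [hA]; ring
  have hη : A ^ (-θ) * ε ^ θ ≤ ((2 : ℝ) ^ n) ^ (-θ) := by
    calc A ^ (-θ) * ε ^ θ = (A / ε) ^ (-θ) := by
          rw [Real.div_rpow hA0.le hε.1.le, Real.rpow_neg hε.1.le, div_inv_eq_mul]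
      _ ≤ _ := Real.rpow_le_rpow_of_nonpos (by positivity) hpow (by linarith)
  obtain ⟨k, hk1, hk2, hk3⟩ : ∃ k : ℕ, (k + 1) * τ ≤ T ∧ s - ε ≤ k * τ ∧ (k + 1) * τ ≤ s + ε := by
    rcases le_or_gt s (T / 2) with h | h
    · have h1 : s ≤ ⌈s / τ⌉₊ * τ := by rw [← div_le_iff₀ hτ0]; exact Nat.le_ceil _
      have h2 : (⌈s / τ⌉₊ : ℝ) * τ < s + τ := by
        have := Nat.ceil_lt_add_one (div_nonneg hs.1 hτ0.le)
        rw [div_add_one hτ0.ne', lt_div_iff₀ hτ0] at this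
        exact this
      exact ⟨⌈s / τ⌉₊, by linarith [hε.2], by linarith [hε.1], by linarith⟩
    · have h1 : (⌊s / τ⌋₊ : ℝ) * τ ≤ s := by
        rw [← le_div_iff₀ hτ0]; exact Nat.floor_le (div_nonneg hs.1 hτ0.le)
      have h2 : s < (⌊s / τ⌋₊ + 1 : ℝ) * τ := by
        rw [← div_lt_iff₀ hτ0]; exact Nat.lt_floor_add_one _
      obtain ⟨j, hj⟩ : ∃ j, ⌊s / τ⌋₊ = j + 1 := Nat.exists_eq_succ_of_ne_zero <| by
        intro h0
        rw [h0] at h2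
        push_cast at h2
        linarith [hε.2]
      rw [hj] at h1 h2
      push_cast at h1 h2
      exact ⟨j, by linarith [hs.2], by linarith, by linarith [hε.1]⟩
  have hk : k < 2 ^ n := by
    rw [← hnτ] at hk1
    have := le_of_mul_le_mul_right hk1 hτ0
    exact_mod_cast this
  have hin (t : ℝ) (ht : t ∈ Icc (k * τ) (k * τ + τ)) : t ∈ Icc 0 T ∧ |t - s| ≤ ε := by
    have : 0 ≤ k * τ := by positivity
    exact ⟨⟨by linarith [ht.1], by linarith [ht.2]⟩,
      abs_le.2 ⟨by linarith [ht.1], by linarith [ht.2]⟩⟩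
  obtain ⟨t, ht, hHt⟩ := H n (by omega) k hk (‖φ‖⁻¹ • φ) (by
    rw [norm_smul, norm_inv, norm_norm, inv_mul_cancel₀ hr.ne'])
  have hbig : A ^ (-θ) * ε ^ θ * ‖φ‖ ≤ |φ (X t - X s)| + |φ (X (k * τ) - X s)| := by
    have h1 : |(‖φ‖⁻¹ • φ) (X t) - (‖φ‖⁻¹ • φ) (X (k * τ))| * ‖φ‖
        = |φ (X t - X s) - φ (X (k * τ) - X s)| := by
      simp only [smul_apply, smul_eq_mul, ← mul_sub, map_sub, abs_mul, abs_inv,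
        abs_norm]
      rw [mul_right_comm, inv_mul_cancel₀ hr.ne', one_mul]
      congr 1; ring
    calc _ ≤ |(‖φ‖⁻¹ • φ) (X t) - (‖φ‖⁻¹ • φ) (X (k * τ))| * ‖φ‖ := by
          gcongr; exact hη.trans hHt
      _ ≤ _ := h1.trans_le (abs_sub _ _)
  rcases le_total |φ (X t - X s)| |φ (X (k * τ) - X s)| with hle | hle
  · have h0 := hin (k * τ) ⟨le_rfl, by linarith⟩
    exact ⟨k * τ, h0.1, h0.2, by linarith⟩
  · have h0 := hin t ht
    exact ⟨t, h0.1, h0.2, by linarith⟩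

/-- The functional on Euclidean space with coefficients `(j p - K) / K`. -/
noncomputable def gridFunctional {ι : Type*} [Fintype ι] (K : ℕ) (j : ι → Fin (2 * K + 1)) :
    StrongDual ℝ (EuclideanSpace ℝ ι) :=
  ∑ p, ((((j p : ℕ) : ℝ) - K) / K) • EuclideanSpace.proj p

/-- The grid functionals form a net of the unit ball of the dual of Euclidean space. -/
lemma exists_norm_sub_gridFunctional_le {ι : Type*} [Fintype ι] {K : ℕ} (hK : 0 < K)
    {φ : StrongDual ℝ (EuclideanSpace ℝ ι)} (hφ : ‖φ‖ ≤ 1) :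
    ∃ j : ι → Fin (2 * K + 1), ‖φ - gridFunctional K j‖ ≤ Fintype.card ι / K := by
  obtain ⟨c, hc, hn⟩ := EuclideanSpace.exists_dual_coeff φ
  have hK' : (0 : ℝ) < K := by exact_mod_cast hK
  have hc1 (p : ι) : |c p| ≤ 1 := by
    rw [← sq_le_one_iff_abs_le_one]
    calc c p ^ 2 ≤ ∑ p, c p ^ 2 :=
          Finset.single_le_sum (f := fun p => c p ^ 2) (fun _ _ => sq_nonneg _) (Finset.mem_univ p)
      _ ≤ 1 := by rw [hn]; exact pow_le_one₀ (norm_nonneg _) hφ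
  have hpos (p : ι) : 0 ≤ c p * K + K := by nlinarith [(abs_le.1 (hc1 p)).1]
  have hlt (p : ι) : ⌊c p * K + K⌋₊ < 2 * K + 1 := by
    rw [Nat.lt_succ_iff]
    apply Nat.floor_le_of_le
    push_cast
    nlinarith [(abs_le.1 (hc1 p)).2]
  refine ⟨fun p => ⟨⌊c p * K + K⌋₊, hlt p⟩, ContinuousLinearMap.opNorm_le_bound _ (by positivity)
    fun x => ?_⟩
  have hd (p : ι) : |c p - ((⌊c p * K + K⌋₊ : ℝ) - K) / K| ≤ 1 / K := by
    have h1 := Nat.floor_le (hpos p)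
    have h2 := Nat.lt_floor_add_one (c p * K + K)
    rw [sub_div' hK'.ne', abs_div, abs_of_pos hK']
    gcongr
    exact abs_le.2 ⟨by linarith, by linarith⟩
  have hx : (φ - gridFunctional K fun p => ⟨⌊c p * K + K⌋₊, hlt p⟩) x
      = ∑ p, (c p - ((⌊c p * K + K⌋₊ : ℝ) - K) / K) * x p := by
    simp [gridFunctional, hc, sub_mul, Finset.sum_sub_distrib, sum_apply]
  rw [hx, Real.norm_eq_abs]
  calc _ ≤ ∑ p : ι, 1 / (K : ℝ) * ‖x‖ := by
        refine (Finset.abs_sum_le_sum_abs _ _).trans (Finset.sum_le_sum fun p _ => ?_)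
        rw [abs_mul]
        exact mul_le_mul (hd p) (PiLp.norm_apply_le x p) (abs_nonneg _) (by positivity)
    _ = _ := by rw [Finset.sum_const, Finset.card_univ, nsmul_eq_mul]; ring

lemma summable_geometric_mul_exp_neg {a q : ℝ} (ha : 0 < a) (hq : 0 < q) (d : ℕ) (C : ℝ) :
    Summable fun n : ℕ => C * ((2 : ℝ) ^ n) ^ d * Real.exp (-a * ((2 : ℝ) ^ n) ^ q) := by
  have h1 : Filter.Tendsto (fun x : ℝ => x ^ (d + 1) * Real.exp (-a * x ^ q)) Filter.atTop
      (nhds 0) := by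
    refine ((tendsto_rpow_mul_exp_neg_mul_atTop_nhds_zero ((d + 1 : ℕ) / q) a ha).comp
      (tendsto_rpow_atTop hq)).congr' ?_
    filter_upwards [Filter.eventually_gt_atTop 0] with x hx
    simp only [Function.comp]
    rw [← Real.rpow_mul hx.le, mul_div_cancel₀ _ hq.ne', Real.rpow_natCast]
  have h2 := h1.comp (tendsto_pow_atTop_atTop_of_one_lt (one_lt_two (α := ℝ)))
  have h3 := h2.isBigO_one ℝ
  refine summable_of_isBigO_nat (summable_geometric_two.mul_left C) ?_
  have h4 := ((Asymptotics.isBigO_refl (fun n : ℕ => C * (1 / 2 : ℝ) ^ n) Filter.atTop).mul h3)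
  simp only [mul_one] at h4
  refine h4.congr_left fun n => ?_
  simp only [Function.comp, one_div, inv_pow]
  field_simp
  ring

namespace IsTwoSidedBrownian

variable {W : ℝ → Ω → EuclideanSpace ℝ (Fin m)}

lemma ae_continuous (hW : IsTwoSidedBrownian W P) :
    ∀ᵐ ω ∂P, Continuous fun t => W t ω := by
  have h1 := ae_all_iff.2 fun k => (hW.forward.brownian k).cont
  have h2 := ae_all_iff.2 fun k => (hW.backward.brownian k).cont
  filter_upwards [h1, h2] with ω h1 h2
  refine (PiLp.continuous_toLp 2 (fun _ : Fin m => ℝ)).comp (f := fun t k => W t ω k)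
    (continuous_pi fun k => ?_)
  have h3 : (fun t : ℝ => W t ω k) = fun t : ℝ => if 0 ≤ t then W (t.toNNReal : ℝ≥0) ω k
      else W (-((-t).toNNReal : ℝ≥0)) ω k := by
    ext t
    split_ifs with h
    · simp [h]
    · simp [Real.coe_toNNReal _ (neg_nonneg.2 (not_le.1 h).le)]
  rw [h3]
  refine Continuous.if_le ((h1 k).comp continuous_real_toNNReal)
    ((h2 k).comp (continuous_real_toNNReal.comp continuous_neg)) continuous_const continuous_id ?_
  rintro _ rfl
  simp

end IsTwoSidedBrownian

lemma continuous_delayedPath (h : Fin N → ℝ) {w : ℝ → EuclideanSpace ℝ (Fin m)}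
    (hw : Continuous w) : Continuous (delayedPath h w) := by
  refine (PiLp.continuous_toLp 2 (fun _ : Fin m × Fin N => ℝ)).comp (continuous_pi fun p => ?_)
  fun_prop

namespace IsTwoSidedBrownian

variable {W : ℝ → Ω → EuclideanSpace ℝ (Fin m)} {h : Fin N → ℝ} {T θ κ : ℝ}

/-- On the event that the delayed path stays bounded, some functional has small oscillation on
some dyadic interval of level `n` only with very small probability. -/
lemma measure_exists_small_oscillation_le (hW : IsTwoSidedBrownian W P) (hT : 0 < T) (hθ : θ < 1)
    (hκ : 0 < κ) (hκT : κ ≤ T) (hgap : ∀ i j, i < j → κ ≤ h j - h i) {M R : ℕ} (hR : 0 < R)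
    (hRM : 2 * (m * N) * (M + 1) ≤ R) (n : ℕ) :
    P ({ω | ∃ k : ℕ, k < 2 ^ n ∧ ∃ φ : StrongDual ℝ (EuclideanSpace ℝ (Fin m × Fin N)), ‖φ‖ = 1 ∧
        ∀ t ∈ Icc ((k : ℝ) * (T / 2 ^ n)) (k * (T / 2 ^ n) + T / 2 ^ n),
          |φ (delayedPath h (fun u => W u ω) t)
            - φ (delayedPath h (fun u => W u ω) (k * (T / 2 ^ n)))| < ((2 : ℝ) ^ n) ^ (-θ)} ∩
      {ω | ∀ t ∈ Icc 0 T, ‖delayedPath h (fun u => W u ω) t‖ ≤ M})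
      ≤ ENNReal.ofReal (2 * (3 * R) ^ (m * N) * ((2 : ℝ) ^ n) ^ (m * N + 1)
          * Real.exp (-(Real.log 2 / 256 * κ) * ((2 : ℝ) ^ n) ^ (2 * θ - 1))) := by
  have := hW.isGaussianProcess.isProbabilityMeasure
  set x : ℝ := (2 : ℝ) ^ n with hx
  have hx1 : 1 ≤ x := one_le_pow₀ one_le_two
  have hx0 : 0 < x := by positivity
  set η : ℝ := x ^ (-θ) with hη
  have hη0 : 0 < η := by positivity
  have hηx : x⁻¹ ≤ η := by
    rw [← Real.rpow_neg_one]
    exact Real.rpow_le_rpow_of_exponent_le hx1 (by linarith)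
  set K : ℕ := R * 2 ^ n with hKdef
  have hK : 0 < K := by positivity
  have hKx : (K : ℝ) = R * x := by rw [hKdef]; push_cast; rfl
  have hRM' : 2 * ((m : ℝ) * N) * (M + 1) ≤ R := by exact_mod_cast hRM
  have hR' : (0 : ℝ) < R := by exact_mod_cast hR
  have hcard : (Fintype.card (Fin m × Fin N) : ℝ) = m * N := by simp
  have hnet : ((m : ℝ) * N) / K * (2 * M) ≤ η := by
    refine le_trans ?_ hηx
    rw [hKx, div_mul_eq_mul_div, div_le_iff₀ (by positivity)]
    have : x⁻¹ * (R * x) = R := by field_simp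
    rw [this]
    have : 0 ≤ (m : ℝ) * N := by positivity
    linarith
  have hnet' : ((m : ℝ) * N) / K ≤ 1 / 2 := by
    rw [hKx, div_le_iff₀ (by positivity)]
    have h1 : 0 ≤ (m : ℝ) * N * M := by positivity
    nlinarith
  let J := {j : Fin m × Fin N → Fin (2 * K + 1) // 1 / 2 ≤ ‖gridFunctional K j‖}
  classical
  have hball (k : ℕ) (j : J) :
      P {ω | ∀ t ∈ Icc (k * (T / x)) (k * (T / x) + κ / x),
          |gridFunctional K j.1 (delayedPath h (fun u => W u ω) t)
            - gridFunctional K j.1 (delayedPath h (fun u => W u ω) (k * (T / x)))| < 2 * η}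
        ≤ ENNReal.ofReal (2 * Real.exp (-(Real.log 2 / 256 * κ) * x ^ (2 * θ - 1))) := by
    rw [← ofReal_measureReal]
    apply ENNReal.ofReal_le_ofReal
    have hκx : κ / x ≤ κ := div_le_self hκ.le hx1
    refine (hW.measure_small_ball_le (by positivity) (fun i j hij => hκx.trans (hgap i j hij)) _ _
      (by positivity)).trans ?_
    gcongr 2 * Real.exp ?_
    have h1 : x ^ (2 * θ - 1) * η ^ 2 * x = 1 := by
      rw [hη, ← Real.rpow_mul_natCast hx0.le, ← Real.rpow_add hx0]
      nth_rewrite 2 [← Real.rpow_one x]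
      rw [← Real.rpow_add hx0]
      convert Real.rpow_zero x using 2
      push_cast; ring
    have h2 : κ / x / (2 * η) ^ 2 = κ / 4 * x ^ (2 * θ - 1) := by
      rw [div_div, div_eq_iff (by positivity)]
      linear_combination -κ * h1
    have h3 : (1 / 4 : ℝ) ≤ ‖gridFunctional K j.1‖ ^ 2 := by nlinarith [j.2]
    have h4 : 0 ≤ Real.log 2 / 16 * (κ / 4 * x ^ (2 * θ - 1)) := by
      have := Real.log_pos one_lt_two
      positivity
    calc _ = -(‖gridFunctional K j.1‖ ^ 2 * (Real.log 2 / 16 * (κ / x / (2 * η) ^ 2))) := by ring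
      _ ≤ _ := by rw [h2]; nlinarith
  have hsub : ({ω | ∃ k : ℕ, k < 2 ^ n ∧
        ∃ φ : StrongDual ℝ (EuclideanSpace ℝ (Fin m × Fin N)), ‖φ‖ = 1 ∧
        ∀ t ∈ Icc ((k : ℝ) * (T / x)) (k * (T / x) + T / x),
          |φ (delayedPath h (fun u => W u ω) t)
            - φ (delayedPath h (fun u => W u ω) (k * (T / x)))| < η} ∩
      {ω | ∀ t ∈ Icc 0 T, ‖delayedPath h (fun u => W u ω) t‖ ≤ M}) ⊆
      ⋃ k : Fin (2 ^ n), ⋃ j : J, {ω | ∀ t ∈ Icc ((k : ℕ) * (T / x)) ((k : ℕ) * (T / x) + κ / x),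
          |gridFunctional K j.1 (delayedPath h (fun u => W u ω) t)
            - gridFunctional K j.1 (delayedPath h (fun u => W u ω) ((k : ℕ) * (T / x)))|
              < 2 * η} := by
    rintro ω ⟨⟨k, hk, φ, hφ, hosc⟩, hM⟩
    obtain ⟨j, hj⟩ := exists_norm_sub_gridFunctional_le hK hφ.le
    rw [hcard] at hj
    have hj2 : 1 / 2 ≤ ‖gridFunctional K j‖ := by
      have := norm_sub_norm_le φ (gridFunctional K j)
      linarith
    refine mem_iUnion.2 ⟨⟨k, hk⟩, mem_iUnion.2 ⟨⟨j, hj2⟩, fun t ht => ?_⟩⟩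
    have hT' : κ / x ≤ T / x := by gcongr
    have hin (t : ℝ) (ht : t ∈ Icc (k * (T / x)) (k * (T / x) + T / x)) : t ∈ Icc 0 T := by
      refine ⟨le_trans (by positivity) ht.1, ht.2.trans ?_⟩
      have h1 : (k : ℝ) + 1 ≤ x := by rw [hx]; exact_mod_cast hk
      calc (k : ℝ) * (T / x) + T / x = (k + 1) * (T / x) := by ring
        _ ≤ x * (T / x) := by gcongr
        _ = T := by field_simp
    have ht' : t ∈ Icc (k * (T / x)) (k * (T / x) + T / x) := ⟨ht.1, ht.2.trans (by linarith)⟩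
    have hk' : k * (T / x) ∈ Icc (k * (T / x)) (k * (T / x) + T / x) :=
      ⟨le_rfl, by linarith [div_pos hT hx0]⟩
    set a := delayedPath h (fun u => W u ω) t
    set b := delayedPath h (fun u => W u ω) (k * (T / x))
    have h1 : |(φ - gridFunctional K j) (a - b)| ≤ η := by
      refine le_trans ?_ hnet
      refine ((φ - gridFunctional K j).le_opNorm _).trans ?_
      have h2 : ‖a - b‖ ≤ 2 * M :=
        (norm_sub_le _ _).trans (by linarith [hM t (hin t ht'), hM _ (hin _ hk')])
      gcongr
    have h2 := hosc t ht'
    calc |gridFunctional K j a - gridFunctional K j b|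
        = |(φ a - φ b) - (φ - gridFunctional K j) (a - b)| := by
          congr 1
          simp only [sub_apply, map_sub]
          ring
      _ ≤ |φ a - φ b| + |(φ - gridFunctional K j) (a - b)| := abs_sub _ _
      _ < 2 * η := by linarith
  have hJ : (Fintype.card J : ℝ) ≤ (3 * R) ^ (m * N) * x ^ (m * N) := by
    calc (Fintype.card J : ℝ) ≤ (Fintype.card (Fin m × Fin N → Fin (2 * K + 1)) : ℕ) := by
          exact_mod_cast Fintype.card_subtype_le _
      _ = (2 * K + 1 : ℝ) ^ (m * N) := by simp
      _ ≤ (3 * R * x) ^ (m * N) := by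
          gcongr
          have : (1 : ℝ) ≤ K := by exact_mod_cast hK
          rw [mul_assoc, ← hKx]
          linarith
      _ = _ := mul_pow _ _ _
  refine (measure_mono hsub).trans ?_
  refine (measure_iUnion_fintype_le _ _).trans ?_
  calc _ ≤ ∑ k : Fin (2 ^ n), ∑ j : J,
        ENNReal.ofReal (2 * Real.exp (-(Real.log 2 / 256 * κ) * x ^ (2 * θ - 1))) :=
        Finset.sum_le_sum fun k _ => (measure_iUnion_fintype_le _ _).trans <|
          Finset.sum_le_sum fun j _ => hball k j
    _ = ENNReal.ofReal (x * (Fintype.card J *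
          (2 * Real.exp (-(Real.log 2 / 256 * κ) * x ^ (2 * θ - 1))))) := by
        rw [Finset.sum_const, Finset.sum_const, Finset.card_univ, Finset.card_univ,
          ← ENNReal.ofReal_nsmul, ← ENNReal.ofReal_nsmul, nsmul_eq_mul, nsmul_eq_mul]
        simp [hx]
    _ ≤ _ := by
        apply ENNReal.ofReal_le_ofReal
        calc _ ≤ x * ((3 * R) ^ (m * N) * x ^ (m * N) *
              (2 * Real.exp (-(Real.log 2 / 256 * κ) * x ^ (2 * θ - 1)))) := by gcongr
          _ = _ := by ring

/-- Almost surely, the delayed path of a two-sided Brownian motion is Hölder rough. -/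
lemma ae_isHolderRough (hW : IsTwoSidedBrownian W P) (hT : 0 < T) (hθ2 : 1 / 2 < θ) (hθ : θ < 1)
    (hh : StrictMono h) :
    ∀ᵐ ω ∂P, IsHolderRough θ (T / 2) T (delayedPath h fun t => W t ω) := by
  have := hW.isGaussianProcess.isProbabilityMeasure
  obtain ⟨κ, hκ, hκT, hgap⟩ : ∃ κ > 0, κ ≤ T ∧ ∀ i j, i < j → κ ≤ h j - h i := by
    have hfin : (insert T ((fun p : Fin N × Fin N => h p.2 - h p.1) '' {p | p.1 < p.2})).Finite :=
      (Set.toFinite _).insert _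
    obtain ⟨κ, hκm, hκ⟩ := Set.exists_min_image _ id hfin ⟨T, mem_insert _ _⟩
    refine ⟨κ, ?_, hκ T (mem_insert _ _),
      fun i j hij => hκ _ (mem_insert_of_mem _ ⟨(i, j), hij, rfl⟩)⟩
    rcases hκm with rfl | ⟨p, hp, rfl⟩
    · exact hT
    · exact sub_pos.2 (hh hp)
  have hBC (M : ℕ) := by
    have hle := hW.measure_exists_small_oscillation_le hT hθ hκ hκT hgap
      (Nat.succ_pos (2 * (m * N) * (M + 1))) (M := M) (Nat.le_succ _)
    have hsum := summable_geometric_mul_exp_neg (a := Real.log 2 / 256 * κ) (q := 2 * θ - 1)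
      (mul_pos (div_pos (Real.log_pos one_lt_two) (by norm_num)) hκ) (by linarith) (m * N + 1)
      (2 * (3 * ((2 * (m * N) * (M + 1)).succ : ℕ)) ^ (m * N))
    exact ae_eventually_notMem
      (ne_top_of_le_ne_top hsum.tsum_ofReal_ne_top (ENNReal.tsum_le_tsum hle))
  filter_upwards [hW.ae_continuous, ae_all_iff.2 hBC] with ω hc hBC
  obtain ⟨C, hC⟩ := isCompact_Icc.exists_bound_of_continuousOn
    (continuous_delayedPath h hc).continuousOn (s := Icc 0 T)
  obtain ⟨M, hM⟩ := exists_nat_ge C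
  obtain ⟨n₀, hn₀⟩ := Filter.eventually_atTop.1 (hBC M)
  refine isHolderRough_of_dyadic hT (by linarith) n₀ fun n hn k hk φ hφ => ?_
  by_contra! hcon
  exact hn₀ n hn ⟨⟨k, hk, φ, hφ, hcon⟩, fun t ht => (hC t ht).trans hM⟩

/-- A modification of a two-sided Brownian motion is a two-sided Brownian motion. -/
lemma congr (hW : IsTwoSidedBrownian W P) {W' : ℝ → Ω → EuclideanSpace ℝ (Fin m)}
    (hm : ∀ t, Measurable (W' t)) (h : ∀ᵐ ω ∂P, ∀ t, W' t ω = W t ω) :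
    IsTwoSidedBrownian W' P where
  measurable := hm
  forward :=
    { brownian k :=
        { toIsPreBrownianReal := (hW.forward.brownian k).toIsPreBrownianReal.congr fun t => by
            filter_upwards [h] with ω hω; rw [hω]
          cont := by
            filter_upwards [h, (hW.forward.brownian k).cont] with ω hω hc
            simpa only [hω] using hc }
      indep := hW.forward.indep.congr fun k => by
        filter_upwards [h] with ω hω; simp only [hω] }
  backward :=
    { brownian k :=
        { toIsPreBrownianReal := (hW.backward.brownian k).toIsPreBrownianReal.congr fun t => by
            filter_upwards [h] with ω hω; rw [hω]
          cont := by
            filter_upwards [h, (hW.backward.brownian k).cont] with ω hω hc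
            simpa only [hω] using hc }
      indep := hW.backward.indep.congr fun k => by
        filter_upwards [h] with ω hω; simp only [hω] }
  indep := hW.indep.congr (by filter_upwards [h] with ω hω; simp only [hω])
    (by filter_upwards [h] with ω hω; simp only [hω])

/-- A property of paths that holds almost surely holds everywhere for some indistinguishable
version. -/
lemma exists_version (hW : IsTwoSidedBrownian W P) {p : (ℝ → EuclideanSpace ℝ (Fin m)) → Prop}
    (hp : ∀ᵐ ω ∂P, p fun t => W t ω) :
    ∃ W' : ℝ → Ω → EuclideanSpace ℝ (Fin m), IsTwoSidedBrownian W' P ∧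
      (∀ᵐ ω ∂P, ∀ t, W' t ω = W t ω) ∧ ∀ ω, p fun t => W' t ω := by
  classical
  have := hW.isGaussianProcess.isProbabilityMeasure
  obtain ⟨ω₀, hω₀⟩ := hp.exists
  set A : Set Ω := (toMeasurable P {ω | ¬ p fun t => W t ω})ᶜ with hA
  have hAm : MeasurableSet A := (measurableSet_toMeasurable _ _).compl
  have hAp : ∀ ω ∈ A, p fun t => W t ω := fun ω hω => by
    by_contra hcon
    exact hω (subset_toMeasurable P _ hcon)
  have hA1 : ∀ᵐ ω ∂P, ω ∈ A := by
    rw [hA, ae_iff]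
    simpa only [mem_compl_iff, not_not, ofPred_mem_eq, measure_toMeasurable] using ae_iff.1 hp
  have hae : ∀ᵐ ω ∂P, ∀ t, (if ω ∈ A then W t ω else W t ω₀) = W t ω := by
    filter_upwards [hA1] with ω hω t
    rw [if_pos hω]
  refine ⟨fun t ω => if ω ∈ A then W t ω else W t ω₀, hW.congr (fun t =>
    (hW.measurable t).ite hAm measurable_const) hae, hae, fun ω => ?_⟩
  by_cases hω : ω ∈ A
  · simpa only [hω, if_true] using hAp ω hω
  · simpa only [hω, if_false] using hω₀

end IsTwoSidedBrownian

lemma minDelayGap_le {h : Fin N → ℝ} (hh : StrictMono h) {i j : Fin N} (hij : i < j) :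
    minDelayGap h ≤ ENNReal.ofReal (h j - h i) := by
  have hi : (i : ℕ) + 1 < N := lt_of_le_of_lt (Nat.succ_le_of_lt hij) j.2
  refine (iInf₂_le (i : ℕ) hi).trans (ENNReal.ofReal_le_ofReal ?_)
  have h1 : h i < h ⟨i + 1, hi⟩ := hh (Fin.lt_def.2 (Nat.lt_succ_self _))
  have h2 : h ⟨i + 1, hi⟩ ≤ h j := hh.monotone (Fin.le_def.2 (Nat.succ_le_of_lt hij))
  rw [abs_sub_comm, abs_of_pos (by simpa using sub_pos.2 h1)]
  simpa using h2

end

theorem mainTheorem3 :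
    -- the version of the Brownian motion with rough delayed paths
    (∀ (Ω : Type*) [MeasurableSpace Ω] (P : Measure Ω) [IsProbabilityMeasure P]
      (m N : ℕ) [NeZero N] (h : Fin N → ℝ) (_ : h 0 = 0) (_ : StrictMono h)
      (W : ℝ → Ω → EuclideanSpace ℝ (Fin m)) (_ : IsTwoSidedBrownian W P)
      (T θ : ℝ) (_ : 0 < T) (_ : 1 / 2 < θ) (_ : θ < 1),
      ∃ W' : ℝ → Ω → EuclideanSpace ℝ (Fin m),
        IsTwoSidedBrownian W' P ∧
        (∀ᵐ ω ∂P, ∀ t : ℝ, W' t ω = W t ω) ∧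
        (∀ ω, Continuous (fun t => W' t ω)) ∧
        ∀ ω, IsHolderRough θ (T / 2) T (delayedPath h (fun t => W' t ω))) ∧
    -- the small-ball estimate, with absolute constants
    (∃ c C : ℝ, 0 < c ∧ 0 < C ∧
      ∀ (Ω : Type*) [MeasurableSpace Ω] (P : Measure Ω) [IsProbabilityMeasure P]
        (m N : ℕ) [NeZero N] (h : Fin N → ℝ) (_ : h 0 = 0) (_ : StrictMono h)
        (W : ℝ → Ω → EuclideanSpace ℝ (Fin m)) (_ : IsTwoSidedBrownian W P)
        (φ : StrongDual ℝ (EuclideanSpace ℝ (Fin m × Fin N))) (s ε δ : ℝ) (_ : 0 < ε) (_ : 0 < δ),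
        P.real {ω | (⨆ t ∈ Icc s (s + δ),
            ‖φ (delayedPath h (fun u => W u ω) t - delayedPath h (fun u => W u ω) s)‖ₑ)
              < ENNReal.ofReal ε}
          ≤ C * Real.exp (-(c * ‖φ‖ ^ 2 * (min (ENNReal.ofReal δ) (minDelayGap h)).toReal)
              / ε ^ 2)) := by
  refine ⟨?_, Real.log 2 / 16, 2, div_pos (Real.log_pos one_lt_two) (by norm_num), two_pos, ?_⟩
  · intro Ω _ P _ m N _ h _ hh W hW T θ hT hθ2 hθ
    obtain ⟨W', h1, h2, h3⟩ := hW.exists_version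
      (p := fun w => Continuous w ∧ IsHolderRough θ (T / 2) T (delayedPath h w))
      (hW.ae_continuous.and (hW.ae_isHolderRough hT hθ2 hθ hh))
    exact ⟨W', h1, h2, fun ω => (h3 ω).1, fun ω => (h3 ω).2⟩
  · intro Ω _ P _ m N _ h _ hh W hW φ s ε δ hε hδ
    set D : ℝ≥0∞ := min (ENNReal.ofReal δ) (minDelayGap h) with hD
    have hDδ : D.toReal ≤ δ := ENNReal.toReal_le_of_le_ofReal hδ.le (min_le_left _ _)
    have hgap (i j : Fin N) (hij : i < j) : D.toReal ≤ h j - h i :=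
      ENNReal.toReal_le_of_le_ofReal (sub_pos.2 (hh hij)).le
        ((min_le_right _ _).trans (minDelayGap_le hh hij))
    refine le_trans (measureReal_mono ?_) (hW.measure_small_ball_le ENNReal.toReal_nonneg hgap φ s hε)
    intro ω hω t ht
    have h1 : ‖φ (delayedPath h (fun u => W u ω) t - delayedPath h (fun u => W u ω) s)‖ₑ
        < ENNReal.ofReal ε :=
      lt_of_le_of_lt (le_iSup₂ (f := fun t (_ : t ∈ Icc s (s + δ)) =>
        ‖φ (delayedPath h (fun u => W u ω) t - delayedPath h (fun u => W u ω) s)‖ₑ) t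
        ⟨ht.1, ht.2.trans (by linarith)⟩) hω
    rw [← ofReal_norm, ENNReal.ofReal_lt_ofReal_iff hε, Real.norm_eq_abs, map_sub] at h1
    exact h1
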